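/- **Definitions.** For a word $w\in\Sigma^+$ and an integer $j\ge 0$ let $i_j(w)$ and $t_j(w)$ be the prefix and the suffix of $w$ of length $j$ (both equal to $w$ if $|w|<j$), and let $F_j(w)$ be the set of factors (contiguous subwords) of $w$ of length $j$. For $k\ge 1$ write $u\sim_k v$ if $i_{k-1}(u)=i_{k-1}(v)$, $t_{k-1}(u)=t_{k-1}(v)$ and $F_k(u)=F_k(v)$. A language $L\subseteq\Sigma^+$ is *$k$-testable* if $u\sim_k v$ implies $u\in L\Leftrightarrow v\in L$ for all $u,v\in\Sigma^+$. A semigroup $S$ is *$k$-testable* if there are an alphabet $\Sigma$ and a surjective morphism $\varphi:\Sigma^+\to S$ such that $u\sim_k v$ implies $\varphi(u)=\varphi(v)$ for all $u,v\in\Sigma^+$. A deterministic finite automaton has a finite set of states, one initial state, a set of accepting states, and a transition function that may be partial. It is *$k$-testable* if the language of nonempty words that it accepts is $k$-testable, and *locally testable* if it is $k$-testable for some $k\ge 1$. It is *reduced* if every state is reachable from the initial state, any two distinct states $p,q$ are inequivalent (some possibly empty word is accepted from exactly one of $p$ and $q$), and, in case some transition is undefined, from every state some word is accepted (no state is equivalent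 to "undefined"). Its *transition semigroup* is the semigroup of all partial transformations of the state set that are induced by nonempty words, under composition. **Theorem 5.2.** Let $S$ be the transition semigroup of a locally testable reduced deterministic finite automaton with $n$ states. Then both $S$ and the automaton are $\left(\frac{n^2-n}{2}+1\right)$-testable. -/

import Mathlib

universe u v

/-- The word (nonempty list of letters) represented by an element of the free semigroup `A⁺`. -/
def FreeSemigroup.letters {A : Type u} (w : FreeSemigroup A) : List A :=
  w.head :: w.tail

theorem FreeSemigroup.letters_mul {A : Type u} (x y : FreeSemigroup A) :
    (x * y).letters = x.letters ++ y.letters := by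
  simp [FreeSemigroup.letters]

/-- The prefix `i_k(w)` of length `k` of `w` (which is `w` itself if `|w| < k`). -/
def wordPrefix {A : Type u} (k : ℕ) (w : FreeSemigroup A) : List A :=
  w.letters.take k

/-- The suffix `t_k(w)` of length `k` of `w` (which is `w` itself if `|w| < k`). -/
def wordSuffix {A : Type u} (k : ℕ) (w : FreeSemigroup A) : List A :=
  w.letters.drop (w.letters.length - k)

/-- The set `F_k(w)` of factors (contiguous subwords) of length `k` of `w`. -/
def wordFactors {A : Type u} (k : ℕ) (w : FreeSemigroup A) : Set (List A) :=
  {f | f.length = k ∧ f <:+: w.letters}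

/-- `u` and `v` have the same prefix and suffix of length `k - 1` and the same factors of
length `k`. Only used for `k ≥ 1`. -/
def SameKTests {A : Type u} (k : ℕ) (u v : FreeSemigroup A) : Prop :=
  wordPrefix (k - 1) u = wordPrefix (k - 1) v ∧
  wordSuffix (k - 1) u = wordSuffix (k - 1) v ∧
  wordFactors k u = wordFactors k v

/-- A language `L ⊆ A⁺` is `k`-testable. -/
def LanguageKTestable {A : Type u} (k : ℕ) (L : Set (FreeSemigroup A)) : Prop :=
  0 < k ∧ ∀ u v : FreeSemigroup A, SameKTests k u v → (u ∈ L ↔ v ∈ L)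

/-- A semigroup `S` is `k`-testable: for some alphabet `A` and some surjective morphism
`φ : A⁺ → S`, words with the same `k`-tests have the same image. (An alphabet in the universe
of `S` is no restriction: a choice of one preimage letter for each element of the image of `A`
gives such an alphabet.) -/
def SemigroupKTestable (k : ℕ) (S : Type u) [Semigroup S] : Prop :=
  0 < k ∧ ∃ (A : Type u) (φ : FreeSemigroup A →ₙ* S), Function.Surjective φ ∧
    ∀ u v : FreeSemigroup A, SameKTests k u v → φ u = φ v

/-- Partial transformations of a set `Q`; `none` means undefined. -/
def PartialTrans (Q : Type u) : Type u := Q → Option Q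

/-- Partial transformations act on the right: `f * g` is "first `f`, then `g`". -/
instance PartialTrans.instSemigroup (Q : Type u) : Semigroup (PartialTrans Q) where
  mul f g := fun q => (f q).bind g
  mul_assoc f g h := funext fun q => Option.bind_assoc (f q) g h

/-- A deterministic automaton with state set `Q` over the alphabet `A`. The transition function
may be partial (`none` means undefined). -/
structure PartialDFA (A : Type u) (Q : Type v) where
  step : Q → A → Option Q
  start : Q
  accept : Set Q

namespace PartialDFA

variable {A : Type u} {Q : Type v}

/-- The state reached from `q` by reading a (possibly empty) word, if it is defined. -/
def run (M : PartialDFA A Q) : Q → List A → Option Q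
  | q, [] => some q
  | q, a :: w => (M.step q a).bind fun r => M.run r w

theorem run_append (M : PartialDFA A Q) (q : Q) (x y : List A) :
    M.run q (x ++ y) = (M.run q x).bind fun r => M.run r y := by
  induction x generalizing q with
  | nil => rfl
  | cons a x ih => simp [run, ih, Option.bind_assoc]

/-- The word `w` (possibly empty) leads from `q` to an accepting state. -/
def AcceptsFrom (M : PartialDFA A Q) (q : Q) (w : List A) : Prop :=
  ∃ r ∈ M.accept, M.run q w = some r

/-- The language in `A⁺` accepted by the automaton. -/
def language (M : PartialDFA A Q) : Set (FreeSemigroup A) :=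
  {w | M.AcceptsFrom M.start w.letters}

/-- The transition semigroup: all partial transformations of the state set induced by
nonempty words. -/
def transitionSemigroup (M : PartialDFA A Q) : Subsemigroup (PartialTrans Q) where
  carrier := {f | ∃ w : FreeSemigroup A, f = fun q => M.run q w.letters}
  mul_mem' := by
    rintro _ _ ⟨x, rfl⟩ ⟨y, rfl⟩
    refine ⟨x * y, funext fun q => ?_⟩
    rw [FreeSemigroup.letters_mul, run_append]
    rfl

/-- The automaton is reduced (minimal): every state is reachable from the initial state, distinct
states are inequivalent, and no state is equivalent to "undefined" if "undefined" occurs.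
In particular a complete automaton may contain one dead state (the sink), and an incomplete one
has none. -/
structure IsReduced (M : PartialDFA A Q) : Prop where
  reachable : ∀ q, ∃ w, M.run M.start w = some q
  inequivalent : ∀ p q, (∀ w, M.AcceptsFrom p w ↔ M.AcceptsFrom q w) → p = q
  not_dead : (∃ q a, M.step q a = none) → ∀ p, ∃ w, M.AcceptsFrom p w

/-- The automaton is `k`-testable: it accepts a `k`-testable language. -/
def KTestable (M : PartialDFA A Q) (k : ℕ) : Prop :=
  LanguageKTestable k M.language

/-- The automaton is locally testable. -/
def LocallyTestable (M : PartialDFA A Q) : Prop :=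
  ∃ k, M.KTestable k

end PartialDFA

/-! Let `m` be `n.choose 2`. Complete the automaton by a sink `none`, which does not count among the
`n` states. Local testability and reducedness make it a `LocallySemilattice`: after a long word `e`,
the words `w e` act as commuting idempotents. What "long" means depends on the unknown order of
testability; the task is to replace that order by `m + 1`.

A word is a path in the de Bruijn graph on words of length `m`: its prefix and suffix are the ends,
its factors of length `m + 1` are the edges. By Simon's theorem (`LoopsSemilattice.act_eq`), paths
with the same ends and edges act equally once the loops at each vertex `t` act as commuting
idempotents on the states `q t`. This is `loop_idem` and `loop_comm`.

Both come from a pigeonhole. While `t` is read from two states that neither die nor merge, `m + 1`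
unordered pairs of distinct states occur, so a pair repeats. The word `u` read in between cannot
swap the two states (`eq_of_swap`), so it fixes both. A power of `u` is then a long word fixing both
states, and the local identities apply there. In particular, two such states in one strong component
coincide (`eq_of_reach`). -/

/-! ### Actions of words on states -/

section Action

variable {α X : Type*}

/-- The state reached from `p` by reading the word `w` in a complete automaton. -/
abbrev act (δ : X → α → X) (p : X) (w : List α) : X := w.foldl δ p

/-- `q` is reachable from `p`. -/
def Reach (δ : X → α → X) (p q : X) : Prop := ∃ w, act δ p w = q

/-- The power `u ^ n` of a word. -/
def wordPow (u : List α) (n : ℕ) : List α := (List.replicate n u).flatten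

/-- `x` labels a loop at `t` in the de Bruijn graph: `t x = X t`. -/
def WordLoop (t X x : List α) : Prop := t ++ x = X ++ t

variable {δ : X → α → X}

theorem Reach.act (p : X) (w : List α) : Reach δ p (act δ p w) := ⟨w, rfl⟩

theorem Reach.trans {p q r : X} (h : Reach δ p q) (h' : Reach δ q r) : Reach δ p r := by
  obtain ⟨w, rfl⟩ := h
  obtain ⟨w', rfl⟩ := h'
  exact ⟨w ++ w', List.foldl_append⟩

theorem act_append (p : X) (u v : List α) : act δ p (u ++ v) = act δ (act δ p u) v :=
  List.foldl_append

theorem wordPow_zero (u : List α) : wordPow u 0 = [] := rfl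

theorem wordPow_succ (u : List α) (n : ℕ) : wordPow u (n + 1) = u ++ wordPow u n := by
  simp [wordPow, List.replicate_succ]

theorem le_length_wordPow {u : List α} (hu : u ≠ []) (n : ℕ) : n ≤ (wordPow u n).length := by
  have : 1 ≤ u.length := List.length_pos_iff.mpr hu
  simp only [wordPow, List.length_flatten, List.map_replicate, List.sum_replicate, smul_eq_mul]
  nlinarith

theorem act_wordPow (p : X) (u : List α) (n : ℕ) :
    act δ p (wordPow u n) = (fun q => act δ q u)^[n] p := by
  induction n generalizing p with
  | zero => rfl
  | succ n ih => rw [wordPow_succ, act_append, ih, Function.iterate_succ_apply]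

theorem act_wordPow_of_fixed {p : X} {u : List α} (h : act δ p u = p) (n : ℕ) :
    act δ p (wordPow u n) = p := by
  rw [act_wordPow]
  exact Function.iterate_fixed h n

namespace WordLoop

variable {t X' x Y y : List α}

theorem append (hx : WordLoop t X' x) (hy : WordLoop t Y y) : WordLoop t (X' ++ Y) (x ++ y) := by
  unfold WordLoop at *
  rw [← List.append_assoc, hx, List.append_assoc, hy, List.append_assoc]

theorem wordPow (hx : WordLoop t X' x) (n : ℕ) : WordLoop t (wordPow X' n) (wordPow x n) := by
  induction n with
  | zero => simp [WordLoop, wordPow_zero]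
  | succ n ih => rw [wordPow_succ, wordPow_succ]; exact hx.append ih

theorem length_eq (hx : WordLoop t X' x) : x.length = X'.length := by
  have := congrArg List.length hx
  simp only [List.length_append] at this
  omega

theorem ne_nil (hx : WordLoop t X' x) (h : X' ≠ []) : x ≠ [] := by
  rw [← List.length_pos_iff] at *
  rwa [hx.length_eq]

theorem act_eq (hx : WordLoop t X' x) (p : X) : act δ (act δ p X') t = act δ (act δ p t) x := by
  rw [← act_append, ← act_append, hx]

/-- The loop is also read as `z` from the point between `a` and `c`; this transfers loops at `t` to
the intermediate states where the pigeonhole finds fixed points. -/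
theorem split {a c : List α} (hx : WordLoop (a ++ c) X' x) :
    ∃ z, WordLoop a X' z ∧ WordLoop c z x := by
  have h1 : a <+: a ++ c ++ x := ⟨c ++ x, by simp⟩
  have h2 : X' ++ a <+: a ++ c ++ x := ⟨c, by rw [hx]; simp⟩
  obtain ⟨z, hz⟩ := List.prefix_of_prefix_length_le h1 h2 (by simp)
  refine ⟨z, hz, ?_⟩
  have : a ++ (c ++ x) = a ++ (z ++ c) := by
    rw [← List.append_assoc, hx, ← List.append_assoc, ← List.append_assoc, hz]
  exact List.append_cancel_left this

/-- Since `t x ^ n = X' ^ n t`, the word `t` is a prefix of any power of `X'` that is at least as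
long. -/
theorem exists_append_eq_wordPow (hx : WordLoop t X' x) (h : X' ≠ []) :
    ∃ n w, t ++ w = _root_.wordPow X' n := by
  refine ⟨t.length, ?_⟩
  have h1 : t <+: t ++ _root_.wordPow x t.length := ⟨_, rfl⟩
  have h2 : _root_.wordPow X' t.length <+: t ++ _root_.wordPow x t.length :=
    ⟨t, (hx.wordPow _).symm⟩
  exact List.prefix_of_prefix_length_le h1 h2 (le_length_wordPow h _)

theorem reach (hx : WordLoop t X' x) (h : X' ≠ []) {p : X} (hp : act δ p X' = p) :
    Reach δ (act δ p t) p := by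
  obtain ⟨n, w, hw⟩ := hx.exists_append_eq_wordPow h
  exact ⟨w, by rw [← act_append, hw, act_wordPow_of_fixed hp]⟩

end WordLoop

/-- For long words `e`, the actions of the words `w e` after `e` are idempotent and commute. -/
structure LocallySemilattice (δ : X → α → X) (N : ℕ) : Prop where
  idem : ∀ e w : List α, N ≤ e.length → ∀ p,
    act δ p (e ++ w ++ e ++ w ++ e) = act δ p (e ++ w ++ e)
  comm : ∀ e w w' : List α, N ≤ e.length → ∀ p,
    act δ p (e ++ w ++ e ++ w' ++ e) = act δ p (e ++ w' ++ e ++ w ++ e)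

namespace LocallySemilattice

variable {N : ℕ}

theorem idem_of_fixed (H : LocallySemilattice δ N) {e : List α} (he : N ≤ e.length) {r : X}
    (hr : act δ r e = r) (w : List α) :
    act δ (act δ (act δ (act δ r w) e) w) e = act δ (act δ r w) e := by
  simpa only [act_append, hr] using H.idem e w he r

theorem comm_of_fixed (H : LocallySemilattice δ N) {e : List α} (he : N ≤ e.length) {r : X}
    (hr : act δ r e = r) (w w' : List α) :
    act δ (act δ (act δ (act δ r w) e) w') e = act δ (act δ (act δ (act δ r w') e) w) e := by
  simpa only [act_append, hr] using H.comm e w w' he r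

/-- With `e = u ^ N`, idempotence for `w = []` and `w = u` gives `u ^ (3N) = u ^ (2N)` and `u ^ (3N
+ 2) = u ^ (2N + 1)`, whence `u ^ (2N + 2) = u ^ (2N + 1)`. -/
theorem aperiodic (H : LocallySemilattice δ N) (u : List α) (p : X) :
    act δ (act δ p (wordPow u (2 * N + 1))) u = act δ p (wordPow u (2 * N + 1)) := by
  rcases eq_or_ne u [] with rfl | hu
  · rfl
  have h0 := H.idem (wordPow u N) [] (le_length_wordPow hu N) p
  have h1 := H.idem (wordPow u N) u (le_length_wordPow hu N) p
  obtain ⟨f, hf⟩ : ∃ f : X → X, ∀ q, act δ q u = f q := ⟨_, fun _ => rfl⟩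
  have hw : ∀ q n, act δ q (wordPow u n) = f^[n] q := by
    intro q n
    rw [act_wordPow, funext hf]
  simp only [List.append_nil, act_append, hw, hf, ← Function.iterate_succ_apply',
    ← Function.iterate_add_apply] at h0 h1 ⊢
  have h2 := congrArg f^[2] h0
  rw [← Function.iterate_add_apply, ← Function.iterate_add_apply] at h2
  rw [show (2 * N + 1).succ = 2 + (N + N) by omega, ← h2,
    show 2 * N + 1 = N + N.succ by omega, ← h1]
  congr 1
  omega

theorem eq_of_swap (H : LocallySemilattice δ N) {u : List α} {r s : X} (h : act δ r u = s)
    (h' : act δ s u = r) : r = s := by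
  have h1 : ∀ n, act δ r (wordPow u (2 * n)) = r := by
    intro n
    induction n with
    | zero => rfl
    | succ n ih =>
      rw [show 2 * (n + 1) = 2 * n + 1 + 1 by ring, wordPow_succ, wordPow_succ, act_append,
        act_append, h, h', ih]
  have h2 : act δ s (wordPow u (2 * N + 1)) = r := by
    rw [wordPow_succ, act_append, h', h1]
  have h3 := H.aperiodic u s
  rw [h2, h] at h3
  exact h3.symm

/-- With `e = u ^ N`, idempotence at `r` shows that `w e` fixes `s`. Commuting `w e` and `w' e` at
`s` then gives `r` on one side and `s` on the other. -/
theorem eq_of_reach (H : LocallySemilattice δ N) {u : List α} (hu : u ≠ []) {r s : X}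
    (hr : act δ r u = r) (hs : act δ s u = s) (hrs : Reach δ r s) (hsr : Reach δ s r) : r = s := by
  obtain ⟨w, hw⟩ := hrs
  obtain ⟨w', hw'⟩ := hsr
  have he := le_length_wordPow hu N
  replace hr := act_wordPow_of_fixed hr N
  replace hs := act_wordPow_of_fixed hs N
  have h1 := H.idem_of_fixed he hr w
  have h2 := H.comm_of_fixed he hs w w'
  rw [hw, hs] at h1
  rw [h1, hw', hr, hw, hs] at h2
  exact h2

end LocallySemilattice

/-- Among more than `n.choose 2` pairs of distinct states out of `n`, one is repeated. -/
theorem exists_pair_repeated {Q : Type*} [Fintype Q] (f g : ℕ → Option Q)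
    (h : ∀ i ≤ (Fintype.card Q).choose 2, f i ≠ none ∧ g i ≠ none ∧ f i ≠ g i) :
    ∃ i j, i < j ∧ j ≤ (Fintype.card Q).choose 2 ∧
      (f i = f j ∧ g i = g j ∨ f i = g j ∧ g i = f j) := by
  classical
  have hex : ∀ i : Fin ((Fintype.card Q).choose 2 + 1), ∃ a b : Q,
      f i = some a ∧ g i = some b ∧ a ≠ b := by
    intro i
    obtain ⟨h1, h2, h3⟩ := h i (Nat.lt_succ_iff.mp i.2)
    obtain ⟨a, ha⟩ := Option.ne_none_iff_exists'.mp h1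
    obtain ⟨b, hb⟩ := Option.ne_none_iff_exists'.mp h2
    exact ⟨a, b, ha, hb, fun hab => h3 (by rw [ha, hb, hab])⟩
  choose a b ha hb hab using hex
  let φ : Fin ((Fintype.card Q).choose 2 + 1) → {z : Sym2 Q // ¬ z.IsDiag} :=
    fun i => ⟨s(a i, b i), by simpa using hab i⟩
  have hcard : Fintype.card {z : Sym2 Q // ¬ z.IsDiag} <
      Fintype.card (Fin ((Fintype.card Q).choose 2 + 1)) := by
    rw [Sym2.card_subtype_not_diag, Fintype.card_fin]
    exact Nat.lt_succ_self _
  obtain ⟨i, j, hij, he⟩ := Fintype.exists_ne_map_eq_of_card_lt φ hcard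
  wlog hlt : i < j generalizing i j
  · exact this j i hij.symm he.symm (lt_of_le_of_ne (not_lt.mp hlt) hij.symm)
  refine ⟨i, j, hlt, Nat.lt_succ_iff.mp j.2, ?_⟩
  have he' : s(a i, b i) = s(a j, b j) := congrArg Subtype.val he
  rw [ha, hb, ha, hb]
  rcases Sym2.eq_iff.mp he' with ⟨h1, h2⟩ | ⟨h1, h2⟩
  · exact Or.inl ⟨by rw [h1], by rw [h2]⟩
  · exact Or.inr ⟨by rw [h1], by rw [h2]⟩

theorem exists_split_of_lt {t : List α} {i j : ℕ} (hij : i < j) (hj : j ≤ t.length) :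
    ∃ u b, u ≠ [] ∧ t = t.take i ++ (u ++ b) ∧ t.take j = t.take i ++ u := by
  refine ⟨(t.take j).drop i, t.drop j, ?_, ?_, ?_⟩
  · rw [← List.length_pos_iff]
    simp only [List.length_drop, List.length_take]
    omega
  · have h : t.take i = (t.take j).take i := by rw [List.take_take, min_eq_left hij.le]
    rw [← List.append_assoc, h, List.take_append_drop, List.take_append_drop]
  · have h : t.take i = (t.take j).take i := by rw [List.take_take, min_eq_left hij.le]
    rw [h, List.take_append_drop]

end Action

/-! ### Pigeonhole on pairs of states -/

section Loops

variable {α Q : Type*} {δ : Option Q → α → Option Q} {N : ℕ}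

theorem act_none (hδ : ∀ a, δ none a = none) (w : List α) : act δ none w = none := by
  induction w with
  | nil => rfl
  | cons a w ih => simpa [act, hδ a] using ih

theorem Reach.eq_none (hδ : ∀ a, δ none a = none) {p : Option Q} (h : Reach δ none p) :
    p = none := by
  obtain ⟨w, rfl⟩ := h
  exact act_none hδ w

theorem act_take_ne_none (hδ : ∀ a, δ none a = none) {p : Option Q} {t : List α}
    (h : act δ p t ≠ none) (i : ℕ) : act δ p (t.take i) ≠ none := by
  intro h0
  rw [← List.take_append_drop i t, act_append, h0] at h
  exact h (act_none hδ _)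

theorem act_take_ne {X : Type*} {δ : X → α → X} {p p' : X} {t : List α}
    (h : act δ p t ≠ act δ p' t) (i : ℕ) : act δ p (t.take i) ≠ act δ p' (t.take i) := by
  intro h0
  rw [← List.take_append_drop i t, act_append, h0, ← act_append] at h
  exact h rfl

theorem Reach.act_take {X : Type*} {δ : X → α → X} (p : X) (t : List α) (i : ℕ) :
    Reach δ (_root_.act δ p (t.take i)) (_root_.act δ p t) :=
  ⟨t.drop i, by rw [← act_append, List.take_append_drop]⟩

/-- Two states that are not merged by a long word pass through a common loop. -/
theorem LocallySemilattice.exists_fixed [Fintype Q] (H : LocallySemilattice δ N)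
    (hδ : ∀ a, δ none a = none) {t : List α} (ht : t.length = (Fintype.card Q).choose 2)
    {p p' : Option Q} (hp : act δ p t ≠ none) (hp' : act δ p' t ≠ none)
    (hne : act δ p t ≠ act δ p' t) :
    ∃ a u b, t = a ++ (u ++ b) ∧ u ≠ [] ∧ act δ (act δ p a) u = act δ p a ∧
      act δ (act δ p' a) u = act δ p' a := by
  obtain ⟨i, j, hij, hj, h⟩ := exists_pair_repeated (fun i => act δ p (t.take i))
    (fun i => act δ p' (t.take i)) fun i _ =>
      ⟨act_take_ne_none hδ hp i, act_take_ne_none hδ hp' i, act_take_ne hne i⟩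
  obtain ⟨u, b, hu, htu, hju⟩ := exists_split_of_lt hij (hj.trans ht.ge)
  refine ⟨t.take i, u, b, htu, hu, ?_⟩
  simp only [hju, act_append] at h
  rcases h with ⟨h1, h2⟩ | ⟨h1, h2⟩
  · exact ⟨h1.symm, h2.symm⟩
  · exact absurd (H.eq_of_swap h2.symm h1.symm) (act_take_ne hne i)

/-- The three-phase pigeonhole argument: pairs `(p₀, p₁)` as long as `p₁` is not in the strong
component of the final state, then pairs `(p₁, p₂)`. -/
theorem LocallySemilattice.act_eq_of_chain [Fintype Q] (H : LocallySemilattice δ N)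
    (hδ : ∀ a, δ none a = none) {t : List α} (ht : t.length = (Fintype.card Q).choose 2)
    {p₀ p₁ p₂ : Option Q} (h01 : act δ p₀ t ≠ act δ p₁ t)
    (r01 : ∀ i, Reach δ (act δ p₀ (t.take i)) (act δ p₁ (t.take i)))
    (r12 : ∀ i, Reach δ (act δ p₁ (t.take i)) (act δ p₂ (t.take i)))
    (hrep : ∀ a u b, t = a ++ (u ++ b) → u ≠ [] → act δ (act δ p₀ a) u = act δ p₀ a →
      act δ (act δ p₁ a) u = act δ p₁ a → Reach δ (act δ p₂ t) (act δ p₁ a)) :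
    act δ p₂ t = act δ p₁ t := by
  classical
  by_contra h21
  have r2 : ∀ i, Reach δ (act δ p₂ (t.take i)) (act δ p₂ t) := Reach.act_take p₂ t
  have hn1 : act δ p₁ t ≠ none := by
    intro h
    have := r12 t.length
    rw [List.take_length, h] at this
    exact h21 (by rw [this.eq_none hδ, h])
  have hn0 : act δ p₀ t ≠ none := by
    intro h
    have := r01 t.length
    rw [List.take_length, h] at this
    exact h01 (by rw [this.eq_none hδ, h])
  -- As `p₁ (t.take i)` always reaches `p₂ t`, this says that both lie in one strong component. If
  -- `p₂ t` is the sink, it never holds, so no pair used below contains the sink.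
  let C : ℕ → Prop := fun i => Reach δ (act δ p₂ t) (act δ p₁ (t.take i))
  have hC2 : ∀ i, C i → Reach δ (act δ p₂ t) (act δ p₂ (t.take i)) := fun i h => h.trans (r12 i)
  have hC0 : ∀ i, Reach δ (act δ p₂ t) (act δ p₀ (t.take i)) → C i := fun i h => h.trans (r01 i)
  have hn2 : ∀ i, C i → act δ p₂ (t.take i) ≠ none := by
    intro i hi h
    have h2 := r2 i
    rw [h] at h2
    have h3 : Reach δ (act δ p₂ t) (act δ p₁ (t.take i)) := hi
    rw [h2.eq_none hδ] at h3
    exact act_take_ne_none hδ hn1 i (h3.eq_none hδ)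
  obtain ⟨i, j, hij, hj, h⟩ := exists_pair_repeated
    (fun i => if C i then act δ p₁ (t.take i) else act δ p₀ (t.take i))
    (fun i => if C i then act δ p₂ (t.take i) else act δ p₁ (t.take i)) (by
      intro i _
      by_cases hi : C i
      · simp only [hi, if_true]
        exact ⟨act_take_ne_none hδ hn1 i, hn2 i hi, act_take_ne (Ne.symm h21) i⟩
      · simp only [hi, if_false]
        exact ⟨act_take_ne_none hδ hn0 i, act_take_ne_none hδ hn1 i, act_take_ne h01 i⟩)
  obtain ⟨u, b, hu, htu, hju⟩ := exists_split_of_lt hij (hj.trans ht.ge)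
  -- A repetition across the two phases would put a state outside the strong component into it;
  -- within a phase, `eq_of_reach` or `hrep` excludes a common loop and `eq_of_swap` a swap.
  by_cases hi : C i <;> by_cases hj' : C j
  · simp only [hi, hj', if_true] at h
    simp only [hju, act_append] at h
    rcases h with ⟨h1, h2⟩ | ⟨h1, h2⟩
    · exact act_take_ne h21 i (H.eq_of_reach hu h2.symm h1.symm ((r2 i).trans hi) (r12 i))
    · exact act_take_ne h21 i (H.eq_of_swap h1.symm h2.symm)
  · simp only [hi, hj', if_true, if_false] at h
    rcases h with ⟨h1, h2⟩ | ⟨h1, h2⟩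
    · exact hj' (h2.subst (motive := Reach δ _) (hC2 i hi))
    · exact hj' (h1.subst (motive := Reach δ _) hi)
  · simp only [hi, hj', if_true, if_false] at h
    rcases h with ⟨h1, h2⟩ | ⟨h1, h2⟩
    · exact hi (h2.symm.subst (motive := Reach δ _) (hC2 j hj'))
    · exact hi (h2.symm.subst (motive := Reach δ _) hj')
  · simp only [hi, hj', if_false] at h
    simp only [hju, act_append] at h
    rcases h with ⟨h1, h2⟩ | ⟨h1, h2⟩
    · exact hi (hrep _ u b htu hu h1.symm h2.symm)
    · exact act_take_ne h01 i (H.eq_of_swap h2.symm h1.symm)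

end Loops

/-! ### Loops act as commuting idempotents -/

section LoopIdentities

variable {α Q : Type*} {δ : Option Q → α → Option Q} {N : ℕ}

/-- If `r` and `r y` are fixed by a long word and `r x` is `r` or `r y`, then reading powers of `x`
from `r y` and then `e` leads back to `r y`. -/
theorem LocallySemilattice.act_wordPow_of_mem {X : Type*} {δ : X → α → X}
    (H : LocallySemilattice δ N) {e : List α} (he : N ≤ e.length) {r s : X} {x y : List α}
    (hr : act δ r e = r) (hs : act δ s e = s) (hy : act δ r y = s)
    (hx : act δ r x = r ∨ act δ r x = s) (j : ℕ) :
    act δ (act δ s (wordPow x j)) e = s := by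
  suffices (act δ (act δ r (wordPow x j)) e = r ∨ act δ (act δ r (wordPow x j)) e = s) ∧
    act δ (act δ s (wordPow x j)) e = s from this.2
  induction j with
  | zero => exact ⟨Or.inl hr, hs⟩
  | succ j ih =>
    have h1 : act δ (act δ r (wordPow x (j + 1))) e = r ∨
        act δ (act δ r (wordPow x (j + 1))) e = s := by
      rw [wordPow_succ, act_append]
      rcases hx with h | h <;> rw [h]
      · exact ih.1
      · exact Or.inr ih.2
    refine ⟨h1, ?_⟩
    rcases h1 with h | h
    · have := H.comm_of_fixed he hr y (wordPow x (j + 1))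
      rwa [hy, hs, h, hy, hs] at this
    · have := H.idem_of_fixed he hr (wordPow x (j + 1))
      rwa [h] at this

variable [Fintype Q]

/-- The chain argument is applied to `q`, `q Y`, `q Y X`. The two alternatives in `hq` serve
`loop_absorb` and `loop_idem` respectively. -/
theorem LocallySemilattice.absorb (H : LocallySemilattice δ N) (hδ : ∀ a, δ none a = none)
    {t : List α} (ht : t.length = (Fintype.card Q).choose 2) {X Y x y : List α}
    (hX : WordLoop t X x) (hY : WordLoop t Y y) {q : Option Q}
    (hq : act δ q X = q ∨ act δ q X = act δ q Y) :
    act δ (act δ (act δ q Y) X) t = act δ (act δ q Y) t := by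
  rcases eq_or_ne X [] with rfl | hX0
  · rfl
  by_cases h01 : act δ q t = act δ (act δ q Y) t
  · have hv : act δ (act δ q t) y = act δ q t := by rw [← hY.act_eq, ← h01]
    rw [hX.act_eq, ← h01, ← hX.act_eq]
    rcases hq with h | h
    · rw [h]
    · rw [h, ← h01]
  refine H.act_eq_of_chain hδ ht h01 (fun i => ?_) (fun i => ?_) ?_
  · have hs := hY
    rw [← List.take_append_drop i t] at hs
    obtain ⟨z, hz, -⟩ := hs.split
    exact ⟨z, (hz.act_eq q).symm⟩
  · have hs := hX
    rw [← List.take_append_drop i t] at hs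
    obtain ⟨z, hz, -⟩ := hs.split
    exact ⟨z, (hz.act_eq _).symm⟩
  · rintro a u b rfl hu hr hs
    obtain ⟨x', hx, hx'⟩ := hX.split
    obtain ⟨y', hy, -⟩ := hY.split
    -- Reading `w` completes the rest `u b` of `t` to a power of `x'`; by `act_wordPow_of_mem`, a
    -- power of `u` then leads back to `q Y a`.
    obtain ⟨j, w, hw⟩ := hx'.exists_append_eq_wordPow (hx.ne_nil hX0)
    have key := H.act_wordPow_of_mem (x := x') (le_length_wordPow hu N)
      (act_wordPow_of_fixed hr N) (act_wordPow_of_fixed hs N) (hy.act_eq q).symm (by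
        rw [← hx.act_eq]
        rcases hq with h | h
        · exact Or.inl (by rw [h])
        · exact Or.inr (by rw [h])) (j + 1)
    refine ⟨w ++ wordPow u N, ?_⟩
    rw [act_append _ a, hx.act_eq, ← act_append, ← act_append, ← List.append_assoc,
      List.append_assoc x', ← List.append_assoc _ w, hw, ← List.append_assoc, ← wordPow_succ,
      act_append, key]

theorem LocallySemilattice.loop_idem (H : LocallySemilattice δ N) (hδ : ∀ a, δ none a = none)
    {t : List α} (ht : t.length = (Fintype.card Q).choose 2) {X x : List α}
    (hX : WordLoop t X x) (q : Option Q) :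
    act δ (act δ (act δ q t) x) x = act δ (act δ q t) x := by
  rw [← hX.act_eq, ← hX.act_eq]
  exact H.absorb hδ ht hX hX (Or.inr rfl)

theorem LocallySemilattice.act_wordPow_loop (H : LocallySemilattice δ N)
    (hδ : ∀ a, δ none a = none) {t : List α} (ht : t.length = (Fintype.card Q).choose 2)
    {X x : List α} (hX : WordLoop t X x) (q : Option Q) (n : ℕ) :
    act δ (act δ q (wordPow X (n + 1))) t = act δ (act δ q t) x := by
  induction n generalizing q with
  | zero => rw [wordPow_succ, wordPow_zero, List.append_nil, hX.act_eq]
  | succ n ih =>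
    rw [wordPow_succ, act_append, ih, hX.act_eq, H.loop_idem hδ ht hX]

theorem LocallySemilattice.loop_absorb (H : LocallySemilattice δ N) (hδ : ∀ a, δ none a = none)
    {t : List α} (ht : t.length = (Fintype.card Q).choose 2) {X Y x y : List α}
    (hX : WordLoop t X x) (hY : WordLoop t Y y) (q : Option Q) :
    act δ (act δ (act δ (act δ q t) x) y) x = act δ (act δ (act δ q t) x) y := by
  -- Replace `q` by `q X ^ (2N + 1)`, which `X` fixes.
  have := H.absorb hδ ht hX hY (Or.inl (H.aperiodic X q))
  rwa [hX.act_eq, hY.act_eq, H.act_wordPow_loop hδ ht hX] at this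

/-- Some `u` fixes both `q a` and `q Z₁ a` for a prefix `a` of `t`. Commuting the two loops around a
power of `u` at `q a`, with `Z₂` absorbed by `q Z₁`, gives a path from `q Z₂ a` to `q Z₁ a`. -/
theorem LocallySemilattice.reach_of_loops (H : LocallySemilattice δ N)
    (hδ : ∀ a, δ none a = none) {t : List α} (ht : t.length = (Fintype.card Q).choose 2)
    {Z₁ Z₂ z₁ z₂ : List α} (h₁ : WordLoop t Z₁ z₁) (h₂ : WordLoop t Z₂ z₂) {q : Option Q}
    (h12 : act δ (act δ q Z₁) Z₂ = act δ q Z₁)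
    (hret : Reach δ (act δ (act δ q Z₂) t) (act δ q Z₂))
    (hn : act δ (act δ q Z₁) t ≠ none) (hne : act δ q t ≠ act δ (act δ q Z₁) t) :
    Reach δ (act δ (act δ q Z₂) t) (act δ (act δ q Z₁) t) := by
  have hq : act δ q t ≠ none := by
    intro h
    rw [h₁.act_eq, h] at hn
    exact hn (act_none hδ _)
  obtain ⟨a, u, b, rfl, hu, hr, hc⟩ := H.exists_fixed hδ ht hq hn hne
  obtain ⟨w₁, hw₁, -⟩ := h₁.split
  obtain ⟨w₂, hw₂, -⟩ := h₂.split
  have h := H.comm_of_fixed (le_length_wordPow hu N) (act_wordPow_of_fixed hr N) w₁ w₂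
  have hc' := act_wordPow_of_fixed hc N
  rw [← hw₁.act_eq, hc', ← hw₂.act_eq, h12, hc', ← hw₂.act_eq] at h
  have h3 : Reach δ (act δ (act δ q Z₂) a) (act δ (act δ q Z₁) a) := by
    rw [h]
    exact (Reach.act _ _).trans ((Reach.act _ _).trans (Reach.act _ _))
  refine hret.trans ((Reach.act _ a).trans (h3.trans ?_))
  rw [act_append _ a]
  exact Reach.act _ _

/-- The states `q x y` and `q y x`, for loops `x` and `y`, are reached by reading `t` from states
`q Z₁` and `q Z₂` that lie on loops in their strong components. -/
theorem LocallySemilattice.exists_loop_words (H : LocallySemilattice δ N)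
    (hδ : ∀ a, δ none a = none) {t : List α} (ht : t.length = (Fintype.card Q).choose 2)
    {X Y x y : List α} (hX : WordLoop t X x) (hY : WordLoop t Y y) (hX0 : X ≠ [])
    (q : Option Q) :
    ∃ Z₁ Z₂ z₁ z₂, WordLoop t Z₁ z₁ ∧ WordLoop t Z₂ z₂ ∧
      act δ (act δ q Z₁) Z₂ = act δ q Z₁ ∧ act δ (act δ q Z₂) Z₁ = act δ q Z₂ ∧
      act δ (act δ q Z₁) t = act δ (act δ (act δ q t) x) y ∧
      act δ (act δ q Z₂) t = act δ (act δ (act δ q t) y) x ∧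
      Reach δ (act δ (act δ q Z₁) t) (act δ q Z₁) ∧
      Reach δ (act δ (act δ q Z₂) t) (act δ q Z₂) := by
  set E := wordPow X (2 * N + 1) with hE
  set F := wordPow Y (2 * N + 1) with hF
  have hE' : WordLoop t E _ := hX.wordPow (2 * N + 1)
  have hF' : WordLoop t F _ := hY.wordPow (2 * N + 1)
  have lE : N ≤ E.length := le_trans (by omega) (le_length_wordPow hX0 (2 * N + 1))
  have tE : ∀ p, act δ (act δ p E) t = act δ (act δ p t) x :=
    fun p => H.act_wordPow_loop hδ ht hX p (2 * N)
  have tF : ∀ p, act δ (act δ p F) t = act δ (act δ p t) y :=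
    fun p => H.act_wordPow_loop hδ ht hY p (2 * N)
  have EX : ∀ p, act δ (act δ p E) X = act δ p E := fun p => H.aperiodic X p
  have EE : ∀ p, act δ (act δ p E) E = act δ p E := fun p => act_wordPow_of_fixed (EX p) _
  have id : ∀ p, act δ (act δ (act δ (act δ (act δ p E) F) E) F) E =
      act δ (act δ (act δ p E) F) E := fun p => by
    simpa only [act_append] using H.idem E F lE p
  -- Both words end in `E`, so `X` fixes the states they lead to, and `E F E F E = E F E` lets each
  -- absorb the other.
  refine ⟨E ++ F ++ E, F ++ E ++ F ++ E, _, _, (hE'.append hF').append hE',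
    ((hF'.append hE').append hF').append hE', ?_, ?_, ?_, ?_, ?_, ?_⟩
  · simp only [act_append, id]
  · simp only [act_append, EE, id]
  · simp only [act_append, tE, tF]
    exact H.loop_absorb hδ ht hX hY q
  · simp only [act_append, tE, tF]
    rw [H.loop_absorb hδ ht hY hX, ← hY.act_eq, H.loop_idem hδ ht hX]
  · exact hX.reach hX0 (by simp only [act_append, EX])
  · exact hX.reach hX0 (by simp only [act_append, EX])

/-- If the two sides differ, `reach_of_loops` in both directions puts them in one strong component,
together with `q Z₁` and `q Z₂`. The pigeonhole for these two states gives a common loop, where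
`eq_of_reach` identifies them. -/
theorem LocallySemilattice.loop_comm (H : LocallySemilattice δ N) (hδ : ∀ a, δ none a = none)
    {t : List α} (ht : t.length = (Fintype.card Q).choose 2) {X Y x y : List α}
    (hX : WordLoop t X x) (hY : WordLoop t Y y) (q : Option Q) :
    act δ (act δ (act δ q t) x) y = act δ (act δ (act δ q t) y) x := by
  rcases eq_or_ne X [] with rfl | hX0
  · obtain rfl : x = [] := List.length_eq_zero_iff.mp hX.length_eq
    rfl
  by_contra hgh
  have hxy := H.loop_absorb hδ ht hX hY q
  have hyx := H.loop_absorb hδ ht hY hX q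
  have hx := H.loop_idem hδ ht hX q
  have hy := H.loop_idem hδ ht hY q
  have hxyy := H.loop_idem hδ ht hY (act δ q X)
  have hyxx := H.loop_idem hδ ht hX (act δ q Y)
  rw [hX.act_eq] at hxyy
  rw [hY.act_eq] at hyxx
  obtain ⟨Z₁, Z₂, z₁, z₂, h₁, h₂, h12, h21, e₁, e₂, r₁, r₂⟩ :=
    H.exists_loop_words hδ ht hX hY hX0 q
  have hv₁ : act δ q t ≠ act δ (act δ q Z₁) t := by
    rw [e₁]
    intro h
    rw [← h] at hxy hxyy
    -- If `q t x y = q t`, then `x` and `y` both fix `q t`, so the two orders agree.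
    exact hgh (by rw [← h, hxyy, hxy])
  have hv₂ : act δ q t ≠ act δ (act δ q Z₂) t := by
    rw [e₂]
    intro h
    rw [← h] at hyx hyxx
    exact hgh (by rw [← h, hyxx, hyx])
  rw [← e₁, ← e₂] at hgh
  have R₁ := H.reach_of_loops hδ ht h₁ h₂ h12 r₂ (hne := hv₁)
  have R₂ := H.reach_of_loops hδ ht h₂ h₁ h21 r₁ (hne := hv₂)
  have n₁ : act δ (act δ q Z₁) t ≠ none := by
    intro h
    have h' : act δ (act δ q Z₂) t ≠ none := fun h' => hgh (by rw [h, h'])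
    have := R₂ h'
    rw [h] at this
    exact h' (this.eq_none hδ)
  have n₂ : act δ (act δ q Z₂) t ≠ none := by
    intro h
    have := R₁ n₁
    rw [h] at this
    exact n₁ (this.eq_none hδ)
  obtain ⟨a, u, b, rfl, hu, hc, hd⟩ := H.exists_fixed hδ ht n₁ n₂ hgh
  have ha : ∀ p, Reach δ (act δ p a) (act δ p (a ++ (u ++ b))) := by
    intro p
    rw [act_append p a]
    exact Reach.act _ _
  have hcd := H.eq_of_reach hu hc hd
    ((ha _).trans ((R₂ n₂).trans (r₂.trans (Reach.act _ a))))
    ((ha _).trans ((R₁ n₁).trans (r₁.trans (Reach.act _ a))))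
  exact hgh (by rw [act_append _ a, hcd, ← act_append])

end LoopIdentities

/-! ### Simon's theorem on paths with the same edges -/

section Paths

variable {V α X : Type*}

/-- The set of edges of the path with label `x` from the vertex `s`. -/
def pathEdges (σ : V → α → V) : V → List α → Set (V × α)
  | _, [] => ∅
  | s, a :: x => insert (s, a) (pathEdges σ (σ s a) x)

variable {σ : V → α → V} {δ : X → α → X}

theorem pathEdges_append (s : V) (x y : List α) :
    pathEdges σ s (x ++ y) = pathEdges σ s x ∪ pathEdges σ (act σ s x) y := by
  induction x generalizing s with
  | nil => simp [pathEdges]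
  | cons a x ih => simp [pathEdges, ih, Set.insert_union]

theorem exists_split_of_mem_pathEdges {s : V} {x : List α} {p : V × α} (h : p ∈ pathEdges σ s x) :
    ∃ x₁ x₂, x = x₁ ++ p.2 :: x₂ ∧ act σ s x₁ = p.1 := by
  induction x generalizing s with
  | nil => exact h.elim
  | cons a x ih =>
    rcases h with rfl | h
    · exact ⟨[], x, rfl, rfl⟩
    · obtain ⟨x₁, x₂, rfl, h2⟩ := ih h
      exact ⟨a :: x₁, x₂, rfl, h2⟩

/-- Loops act as commuting idempotents on the states that may occur at their vertex. -/
structure LoopsSemilattice (σ : V → α → V) (δ : X → α → X) (R : X → V → Prop) : Prop where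
  step : ∀ p s a, R p s → R (δ p a) (σ s a)
  idem : ∀ p s x, R p s → act σ s x = s → act δ (act δ p x) x = act δ p x
  comm : ∀ p s x y, R p s → act σ s x = s → act σ s y = s →
    act δ (act δ p x) y = act δ (act δ p y) x

namespace LoopsSemilattice

variable {R : X → V → Prop}

theorem act_mem (H : LoopsSemilattice σ δ R) {p : X} {s : V} (h : R p s) (x : List α) :
    R (act δ p x) (act σ s x) := by
  induction x generalizing p s with
  | nil => exact h
  | cons a x ih => exact ih (H.step p s a h)

/-- The last edge `c` of the added path already occurs in `x = x₁ c x₂`, so `c x₂ z` is a loop after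
`x₁`. By idempotence it may be repeated, and its second passage undoes the step `c`. -/
theorem exists_return (H : LoopsSemilattice σ δ R) {p : X} {s : V} (h : R p s) {x z : List α}
    (hz : pathEdges σ (act σ s x) z ⊆ pathEdges σ s x) :
    ∃ w, act σ s (x ++ z ++ w) = act σ s x ∧ act δ p (x ++ z ++ w) = act δ p x := by
  induction z using List.reverseRecOn with
  | nil => exact ⟨[], by simp, by simp⟩
  | append_singleton z c ih =>
    rw [pathEdges_append] at hz
    obtain ⟨w, hw1, hw2⟩ := ih (Set.subset_union_left.trans hz)
    obtain ⟨x₁, x₂, hx, hv⟩ := exists_split_of_mem_pathEdges (hz (Or.inr (Or.inl rfl)))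
    simp only at hx hv
    have hxz : x ++ z = x₁ ++ (c :: x₂ ++ z) := by rw [← List.append_assoc, ← hx]
    have hv' : act σ s (x ++ z) = act σ s x₁ := by rw [act_append, hv]
    have hl : act σ (act σ s x₁) (c :: x₂ ++ z) = act σ s x₁ := by
      rw [← act_append, ← hxz, hv']
    have hi := H.idem _ _ _ (H.act_mem h x₁) hl
    rw [← act_append p x₁, ← hxz] at hi
    have he : x ++ (z ++ [c]) ++ (x₂ ++ (z ++ w)) = (x ++ z) ++ (c :: x₂ ++ z) ++ w := by simp
    refine ⟨x₂ ++ (z ++ w), ?_, ?_⟩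
    · rw [he, act_append _ _ w, act_append _ (x ++ z), hv', hl, ← hv', ← act_append, hw1]
    · rw [he, act_append _ _ w, act_append _ (x ++ z), hi, ← act_append, hw2]

/-- Take a return loop `w` with `p x z w = p x`. Since `z` and `w` commute and `z` is idempotent, `p
x z = p x z w z = p x z w = p x`. -/
theorem loop_absorb (H : LoopsSemilattice σ δ R) {p : X} {s : V} (h : R p s) {x z : List α}
    (hl : act σ (act σ s x) z = act σ s x)
    (hz : pathEdges σ (act σ s x) z ⊆ pathEdges σ s x) :
    act δ (act δ p x) z = act δ p x := by
  obtain ⟨w, hw1, hw2⟩ := H.exists_return h hz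
  have hR := H.act_mem h x
  rw [act_append, act_append] at hw1 hw2
  rw [hl] at hw1
  have h1 := H.comm _ _ z w hR hl hw1
  have h2 := H.idem _ _ z hR hl
  have hR' := H.act_mem hR z
  rw [hl] at hR'
  have h3 := H.comm _ _ z w hR' hl hw1
  rw [h2, hw2] at h3
  exact h3.symm

/-- Two paths with the same edges and the same ends act equally if there is a path back. -/
theorem act_eq_of_return (H : LoopsSemilattice σ δ R) {p : X} {s : V} (h : R p s) {x y w : List α}
    (hxy : act σ s x = act σ s y) (he : pathEdges σ s x = pathEdges σ s y)
    (hw : act σ (act σ s x) w = s) (hwe : pathEdges σ (act σ s x) w ⊆ pathEdges σ s x) :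
    act δ p x = act δ p y := by
  have hx : act σ s (x ++ w) = s := by rw [act_append, hw]
  have hy : act σ s (y ++ w) = s := by rw [act_append, ← hxy, hw]
  have h1 : act δ (act δ p x) (w ++ y ++ (w ++ x)) = act δ p x := by
    apply H.loop_absorb h
    · simp only [act_append, hw, ← hxy]
    · simp only [pathEdges_append, act_append, hw, ← hxy, ← he, Set.union_self,
        Set.union_subset_iff, hwe, Set.Subset.rfl, true_and]
  have h2 : act δ (act δ p y) (w ++ x ++ (w ++ x)) = act δ p y := by
    apply H.loop_absorb h
    · simp only [act_append, hw, ← hxy]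
    · simp only [pathEdges_append, act_append, hw, ← hxy, ← he, Set.union_self,
        Set.union_subset_iff, hwe, Set.Subset.rfl, true_and]
  -- The loops `x w` and `y w` commute at `p`. After a further `x`, one side collapses to `p x` and
  -- the other to `p y`.
  have h3 := congrArg (fun q => act δ q x) (H.comm p s _ _ h hx hy)
  simp only [act_append] at h1 h2 h3
  rw [← h1, h3, h2]

end LoopsSemilattice

theorem exists_split_of_not {P : V → Prop} {s : V} {x : List α} (hs : P s)
    (hx : ¬ P (act σ s x)) :
    ∃ x₁ b x₂, x = x₁ ++ b :: x₂ ∧ P (act σ s x₁) ∧ ¬ P (σ (act σ s x₁) b) := by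
  induction x generalizing s with
  | nil => exact absurd hs hx
  | cons a x ih =>
    by_cases h : P (σ s a)
    · obtain ⟨x₁, b, x₂, rfl, h1, h2⟩ := ih h hx
      exact ⟨a :: x₁, b, x₂, rfl, h1, h2⟩
    · exact ⟨[], a, x, rfl, hs, h⟩

/-- An edge that leads from the vertices with a path back to the start to the other vertices
separates the edges of a path. -/
theorem pathEdges_of_bridge {P : V → Prop} {s : V} {x₁ x₂ : List α} {b : α}
    (hP : ∀ v u, pathEdges σ v u ⊆ pathEdges σ s (x₁ ++ b :: x₂) → P (act σ v u) → P v)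
    (h1 : P (act σ s x₁)) (h2 : ¬ P (σ (act σ s x₁) b)) :
    pathEdges σ s x₁ = {f ∈ pathEdges σ s (x₁ ++ b :: x₂) | P (σ f.1 f.2)} ∧
      pathEdges σ (σ (act σ s x₁) b) x₂ =
        {f ∈ pathEdges σ s (x₁ ++ b :: x₂) | ¬ P (σ f.1 f.2) ∧ f ≠ (act σ s x₁, b)} := by
  have hE : ∀ f, f ∈ pathEdges σ s (x₁ ++ b :: x₂) ↔ f ∈ pathEdges σ s x₁ ∨
      f = (act σ s x₁, b) ∨ f ∈ pathEdges σ (σ (act σ s x₁) b) x₂ := by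
    intro f
    rw [pathEdges_append]
    rfl
  have A : ∀ f ∈ pathEdges σ s x₁, P (σ f.1 f.2) := by
    intro f hf
    obtain ⟨u, u', hu, hv⟩ := exists_split_of_mem_pathEdges hf
    have hin : ∀ g ∈ pathEdges σ (σ f.1 f.2) u', g ∈ pathEdges σ s x₁ := by
      intro g hg
      rw [hu, pathEdges_append, hv]
      exact Or.inr (Or.inr hg)
    refine hP _ u' (fun g hg => (hE g).mpr (Or.inl (hin g hg))) ?_
    rw [hu, act_append, hv] at h1
    exact h1
  have B : ∀ f ∈ pathEdges σ (σ (act σ s x₁) b) x₂, ¬ P f.1 ∧ ¬ P (σ f.1 f.2) := by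
    intro f hf
    obtain ⟨u, u', hu, hv⟩ := exists_split_of_mem_pathEdges hf
    have hin : pathEdges σ (σ (act σ s x₁) b) (u ++ [f.2]) ⊆
        pathEdges σ (σ (act σ s x₁) b) x₂ := by
      rw [hu, show u ++ f.2 :: u' = u ++ [f.2] ++ u' by simp, pathEdges_append _ (u ++ [f.2])]
      exact Set.subset_union_left
    constructor
    · intro h
      refine h2 (hP _ u (fun g hg => (hE g).mpr (Or.inr (Or.inr (hin ?_)))) (by rwa [hv]))
      rw [pathEdges_append]
      exact Or.inl hg
    · intro h
      refine h2 (hP _ (u ++ [f.2]) (fun g hg => (hE g).mpr (Or.inr (Or.inr (hin hg)))) ?_)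
      rw [act_append, hv]
      exact h
  constructor <;> ext f <;> simp only [Set.mem_ofPred_eq, hE]
  · constructor
    · exact fun hf => ⟨Or.inl hf, A f hf⟩
    · rintro ⟨hf | rfl | hf, h⟩
      · exact hf
      · exact absurd h h2
      · exact absurd h (B f hf).2
  · constructor
    · refine fun hf => ⟨Or.inr (Or.inr hf), (B f hf).2, ?_⟩
      rintro rfl
      exact (B _ hf).1 h1
    · rintro ⟨hf | rfl | hf, h, h'⟩
      · exact absurd (A f hf) h
      · exact absurd rfl h'
      · exact hf

/-- Simon's theorem: if loops act as commuting idempotents, then any two paths with the same ends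
and the same edges act equally. -/
theorem LoopsSemilattice.act_eq {R : X → V → Prop} (H : LoopsSemilattice σ δ R) {p : X} {s : V}
    (h : R p s) {x y : List α} (hxy : act σ s x = act σ s y)
    (he : pathEdges σ s x = pathEdges σ s y) : act δ p x = act δ p y := by
  induction hn : x.length using Nat.strong_induction_on generalizing p s x y with
  | _ n ih =>
    -- If the end has no path back within the edges of `x`, an edge leaving `P` is a bridge: `y`
    -- uses it too, and `P` alone determines the edge sets on its two sides. Hence the pieces of `x`
    -- and `y` match and induction applies to each.
    let P : V → Prop := fun v => ∃ w, act σ v w = s ∧ pathEdges σ v w ⊆ pathEdges σ s x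
    by_cases hret : P (act σ s x)
    · obtain ⟨w, hw, hwe⟩ := hret
      exact H.act_eq_of_return h hxy he hw hwe
    have hP : ∀ v u, pathEdges σ v u ⊆ pathEdges σ s x → P (act σ v u) → P v := by
      rintro v u hu ⟨w, hw, hwe⟩
      refine ⟨u ++ w, by rw [act_append, hw], ?_⟩
      rw [pathEdges_append]
      exact Set.union_subset hu hwe
    have hs : P s := ⟨[], rfl, Set.empty_subset _⟩
    obtain ⟨x₁, b, x₂, hx, h1, h2⟩ := exists_split_of_not hs hret
    have hb : (act σ s x₁, b) ∈ pathEdges σ s y := by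
      rw [← he, hx, pathEdges_append]
      exact Or.inr (Or.inl rfl)
    obtain ⟨y₁, y₂, hy, hv⟩ := exists_split_of_mem_pathEdges hb
    simp only at hy hv
    obtain ⟨ex₁, ex₂⟩ := pathEdges_of_bridge (x₂ := x₂) (hx ▸ hP) h1 h2
    rw [← hv] at h1 h2
    obtain ⟨ey₁, ey₂⟩ := pathEdges_of_bridge (x₂ := y₂) (hy ▸ he ▸ hP) h1 h2
    rw [← hx] at ex₁ ex₂
    rw [← hy, ← he] at ey₁ ey₂
    rw [hv] at ey₂
    have l : x.length = x₁.length + (x₂.length + 1) := by rw [hx]; simp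
    have i1 := ih x₁.length (by omega) h hv.symm (ex₁.trans ey₁.symm) rfl
    have hR := H.step _ _ b (H.act_mem h x₁)
    have hend : act σ (σ (act σ s x₁) b) x₂ = act σ (σ (act σ s x₁) b) y₂ := by
      have h' := hxy
      rw [hx, hy, act_append, act_append, hv] at h'
      exact h'
    have i2 := ih x₂.length (by omega) hR hend (ex₂.trans ey₂.symm) rfl
    rw [hx, hy, act_append, act_append, ← i1]
    exact i2

end Paths

/-! ### Words as paths in the de Bruijn graph -/

section DeBruijn

variable {α Q : Type*}

/-- The transition function of the de Bruijn graph: append a letter and drop the first one. -/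
def deBruijnStep (s : List α) (a : α) : List α := (s ++ [a]).tail

theorem length_deBruijnStep (s : List α) (a : α) : (deBruijnStep s a).length = s.length := by
  simp [deBruijnStep]

theorem deBruijnStep_append (s : List α) (a : α) (x : List α) :
    deBruijnStep s a ++ x = (s ++ a :: x).tail := by
  rw [deBruijnStep, ← List.tail_append_of_ne_nil (by simp)]
  simp

theorem act_deBruijnStep (s x : List α) : act deBruijnStep s x = (s ++ x).drop x.length := by
  induction x generalizing s with
  | nil => simp
  | cons a x ih =>
    change act deBruijnStep (deBruijnStep s a) x = _
    rw [ih, deBruijnStep_append, List.drop_tail, List.length_cons]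

theorem factors_append_eq_image {s : List α} {m : ℕ} (hs : s.length = m) (x : List α) :
    {f | f.length = m + 1 ∧ f <:+: s ++ x} =
      (fun e : List α × α => e.1 ++ [e.2]) '' pathEdges deBruijnStep s x := by
  induction x generalizing s with
  | nil =>
    ext f
    simp only [List.append_nil, Set.mem_ofPred_eq, pathEdges, Set.image_empty,
      Set.mem_empty_iff_false, iff_false, not_and]
    intro hf h
    have := h.length_le
    omega
  | cons a x ih =>
    rw [pathEdges, Set.image_insert_eq, ← ih ((length_deBruijnStep s a).trans hs),
      deBruijnStep_append]
    ext f
    simp only [Set.mem_ofPred_eq, Set.mem_insert_iff]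
    obtain ⟨b, l, hbl⟩ : ∃ b l, s ++ a :: x = b :: l := by
      cases s <;> simp
    have hp : s ++ [a] <+: s ++ a :: x := ⟨x, by simp⟩
    have hl : (s ++ [a]).length = m + 1 := by simp [hs]
    constructor
    · rintro ⟨hf, h⟩
      rw [hbl, List.infix_cons_iff] at h
      rcases h with h | h
      · rw [← hbl] at h
        exact Or.inl (List.IsPrefix.eq_of_length
          (List.prefix_of_prefix_length_le h hp (by omega)) (by omega))
      · exact Or.inr ⟨hf, by rwa [hbl]⟩
    · rintro (rfl | ⟨hf, h⟩)
      · exact ⟨hl, hp.isInfix⟩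
      · exact ⟨hf, h.trans (List.tail_suffix _).isInfix⟩

theorem LocallySemilattice.loopsSemilattice [Fintype Q] {δ : Option Q → α → Option Q} {N : ℕ}
    (H : LocallySemilattice δ N) (hδ : ∀ a, δ none a = none) :
    LoopsSemilattice deBruijnStep δ fun p s =>
      s.length = (Fintype.card Q).choose 2 ∧ ∃ q, p = act δ q s := by
  have hl : ∀ s x : List α, act deBruijnStep s x = s → WordLoop s ((s ++ x).take x.length) x := by
    intro s x h
    rw [act_deBruijnStep] at h
    exact (List.take_append_drop x.length (s ++ x)).symm.trans (by rw [h])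
  refine ⟨?_, ?_, ?_⟩
  · rintro p s a ⟨hs, q, rfl⟩
    refine ⟨(length_deBruijnStep s a).trans hs, ?_⟩
    obtain ⟨b, l, hbl⟩ : ∃ b l, s ++ [a] = b :: l := by
      cases s <;> simp
    refine ⟨δ q b, ?_⟩
    have h : act δ (act δ q s) [a] = act δ q (s ++ [a]) := (act_append q s [a]).symm
    rw [hbl] at h
    rw [deBruijnStep, hbl]
    exact h
  · rintro p s x ⟨hs, q, rfl⟩ hx
    exact H.loop_idem hδ hs (hl s x hx) q
  · rintro p s x y ⟨hs, q, rfl⟩ hx hy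
    exact H.loop_comm hδ hs (hl s x hx) (hl s y hy) q

/-- Words with the same prefix and suffix of length `m` and the same factors of length `m + 1`,
where `m = n.choose 2`, act equally on `n` states. -/
theorem LocallySemilattice.act_eq [Fintype Q] {δ : Option Q → α → Option Q} {N : ℕ}
    (H : LocallySemilattice δ N) (hδ : ∀ a, δ none a = none) {m : ℕ}
    (hm : m = (Fintype.card Q).choose 2) {u v : List α} (h1 : u.take m = v.take m)
    (h2 : u.drop (u.length - m) = v.drop (v.length - m))
    (h3 : {f | f.length = m + 1 ∧ f <:+: u} = {f | f.length = m + 1 ∧ f <:+: v})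
    (p : Option Q) : act δ p u = act δ p v := by
  have hlen := congrArg List.length h1
  simp only [List.length_take] at hlen
  rcases lt_or_ge u.length m with hu | hu
  · rw [List.take_of_length_le (by omega), List.take_of_length_le (by omega)] at h1
    rw [h1]
  have hs : (u.take m).length = m := by simp [hu]
  obtain ⟨s, x, rfl, hx⟩ : ∃ s x, u = s ++ x ∧ s = u.take m :=
    ⟨_, _, (List.take_append_drop m u).symm, rfl⟩
  obtain ⟨y, rfl⟩ : ∃ y, v = s ++ y := ⟨v.drop m, by rw [hx, h1, List.take_append_drop]⟩
  rw [← hx] at hs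
  rw [factors_append_eq_image hs, factors_append_eq_image hs] at h3
  have hinj : Function.Injective fun e : List α × α => e.1 ++ [e.2] := by
    rintro ⟨l, a⟩ ⟨l', a'⟩ h
    simpa using h
  have hE := hinj.image_injective h3
  rw [act_append, act_append]
  refine (H.loopsSemilattice hδ).act_eq ⟨hs.trans hm, p, rfl⟩ ?_ hE
  rw [act_deBruijnStep, act_deBruijnStep]
  simpa [hs] using h2

theorem factors_append_append {k : ℕ} {e : List α} (he : k ≤ e.length + 1) (x y : List α) :
    {f | f.length = k ∧ f <:+: x ++ e ++ y} =
      {f | f.length = k ∧ f <:+: x ++ e} ∪ {f | f.length = k ∧ f <:+: e ++ y} := by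
  ext f
  simp only [Set.mem_ofPred_eq, Set.mem_union]
  constructor
  · rintro ⟨hf, p, q, h⟩
    have hlen := congrArg List.length h
    simp only [List.length_append] at hlen
    by_cases hp : p.length + k ≤ x.length + e.length
    · left
      have h1 : p ++ f <+: x ++ e ++ y := ⟨q, h⟩
      have h2 := List.prefix_of_prefix_length_le h1 (List.prefix_append (x ++ e) y)
        (by simpa [hf] using hp)
      exact ⟨hf, (List.suffix_append p f).isInfix.trans h2.isInfix⟩
    · right
      have h1 : f ++ q <:+ x ++ e ++ y := ⟨p, by rw [← h, List.append_assoc]⟩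
      have h2 : e ++ y <:+ x ++ e ++ y := ⟨x, by rw [List.append_assoc]⟩
      have h3 := List.suffix_of_suffix_length_le h1 h2 (by
        simp only [List.length_append]
        omega)
      exact ⟨hf, (List.prefix_append f q).isInfix.trans h3.isInfix⟩
  · rintro (⟨hf, h⟩ | ⟨hf, h⟩)
    · exact ⟨hf, h.trans (List.prefix_append _ _).isInfix⟩
    · refine ⟨hf, h.trans ?_⟩
      rw [List.append_assoc]
      exact (List.suffix_append _ _).isInfix

theorem drop_length_sub_append {j : ℕ} {l₂ : List α} (h : j ≤ l₂.length) (l₁ : List α) :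
    (l₁ ++ l₂).drop ((l₁ ++ l₂).length - j) = l₂.drop (l₂.length - j) := by
  rw [List.length_append, Nat.add_sub_assoc h, List.drop_append]
  simp

end DeBruijn

/-! ### From testability of the automaton to the local identities, and back -/

section Automaton


variable {A : Type u} {Q : Type v}

theorem FreeSemigroup.exists_letters_eq {w : List A} (hw : w ≠ []) :
    ∃ u : FreeSemigroup A, u.letters = w := by
  obtain ⟨a, l, rfl⟩ := List.exists_cons_of_ne_nil hw
  exact ⟨⟨a, l⟩, rfl⟩

theorem sameKTests_of_factors_eq {k : ℕ} {e : List A} (he : k ≤ e.length) {x y w w' : List A}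
    {u v : FreeSemigroup A} (hu : u.letters = x ++ (e ++ w ++ e) ++ y)
    (hv : v.letters = x ++ (e ++ w' ++ e) ++ y)
    (h : {f | f.length = k ∧ f <:+: e ++ w ++ e} = {f | f.length = k ∧ f <:+: e ++ w' ++ e}) :
    SameKTests k u v := by
  have a1 : ∀ z, x ++ (e ++ z ++ e) ++ y = (x ++ e) ++ (z ++ (e ++ y)) := by simp
  have a2 : ∀ z, x ++ (e ++ z ++ e) ++ y = (x ++ (e ++ z)) ++ (e ++ y) := by simp
  have a3 : ∀ z, x ++ (e ++ z ++ e) ++ y = x ++ e ++ (z ++ e ++ y) := by simp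
  have a4 : ∀ z, e ++ (z ++ e ++ y) = (e ++ z) ++ e ++ y := by simp
  refine ⟨?_, ?_, ?_⟩
  · have h1 : ∀ z, (x ++ e ++ z).take (k - 1) = (x ++ e).take (k - 1) := fun z =>
      List.take_append_of_le_length (by rw [List.length_append]; omega)
    rw [wordPrefix, wordPrefix, hu, hv, a1, a1, h1, h1]
  · have h1 : k - 1 ≤ (e ++ y).length := by rw [List.length_append]; omega
    rw [wordSuffix, wordSuffix, hu, hv, a2, a2, drop_length_sub_append h1,
      drop_length_sub_append h1]
  · rw [wordFactors, wordFactors, hu, hv, a3, a3, factors_append_append (by omega),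
      factors_append_append (by omega) x, a4, a4, factors_append_append (by omega),
      factors_append_append (by omega) (e ++ w'), h]

namespace PartialDFA

/-- The completion of a partial automaton by the sink `none`. -/
def optionStep (M : PartialDFA A Q) (p : Option Q) (a : A) : Option Q := p.bind (M.step · a)

theorem act_optionStep (M : PartialDFA A Q) (p : Option Q) (w : List A) :
    act M.optionStep p w = p.bind (M.run · w) := by
  induction w generalizing p with
  | nil => cases p <;> rfl
  | cons a w ih =>
    change act M.optionStep (M.optionStep p a) w = _
    rw [ih]
    cases p <;> rfl

theorem exists_step_eq_none (M : PartialDFA A Q) {q : Q} {w : List A} (h : M.run q w = none) :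
    ∃ q a, M.step q a = none := by
  induction w generalizing q with
  | nil => simp [run] at h
  | cons a w ih =>
    cases hs : M.step q a with
    | none => exact ⟨q, a, hs⟩
    | some r =>
      rw [run, hs] at h
      exact ih h

theorem acceptsFrom_append (M : PartialDFA A Q) {q r : Q} {u : List A} (h : M.run q u = some r)
    (w : List A) : M.AcceptsFrom q (u ++ w) ↔ M.AcceptsFrom r w := by
  rw [AcceptsFrom, AcceptsFrom, run_append, h]
  rfl

theorem not_acceptsFrom_append (M : PartialDFA A Q) {q : Q} {u : List A} (h : M.run q u = none)
    (w : List A) : ¬ M.AcceptsFrom q (u ++ w) := by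
  rw [AcceptsFrom, run_append, h]
  simp

/-- In a reduced automaton, syntactically equivalent words act equally. -/
theorem IsReduced.run_eq {M : PartialDFA A Q} (hM : M.IsReduced) {u v : List A}
    (h : ∀ x y, M.AcceptsFrom M.start (x ++ u ++ y) ↔ M.AcceptsFrom M.start (x ++ v ++ y))
    (q : Q) : M.run q u = M.run q v := by
  obtain ⟨x, hx⟩ := hM.reachable q
  have h' : ∀ y, M.AcceptsFrom q (u ++ y) ↔ M.AcceptsFrom q (v ++ y) := by
    intro y
    rw [← M.acceptsFrom_append hx, ← M.acceptsFrom_append hx, ← List.append_assoc,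
      ← List.append_assoc]
    exact h x y
  cases hu : M.run q u with
  | none =>
    cases hv : M.run q v with
    | none => rfl
    | some r =>
      obtain ⟨y, hy⟩ := hM.not_dead (M.exists_step_eq_none hu) r
      rw [← M.acceptsFrom_append hv, ← h'] at hy
      exact absurd hy (M.not_acceptsFrom_append hu y)
  | some r =>
    cases hv : M.run q v with
    | none =>
      obtain ⟨y, hy⟩ := hM.not_dead (M.exists_step_eq_none hv) r
      rw [← M.acceptsFrom_append hu, h'] at hy
      exact absurd hy (M.not_acceptsFrom_append hv y)
    | some r' =>
      refine congrArg some (hM.inequivalent r r' fun y => ?_)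
      rw [← M.acceptsFrom_append hu, h', M.acceptsFrom_append hv]

/-- A factor of length `k` cannot stick out of an occurrence of `e` on both sides, so the factors of
`e w e w' e` are those of `e w e` and of `e w' e`. Repeating or permuting such pieces is invisible
to the tests. -/
theorem IsReduced.locallySemilattice {M : PartialDFA A Q} (hM : M.IsReduced) {k : ℕ}
    (hk : M.KTestable k) : LocallySemilattice M.optionStep k := by
  have key : ∀ e w w' : List A, k ≤ e.length →
      {f | f.length = k ∧ f <:+: e ++ w ++ e} = {f | f.length = k ∧ f <:+: e ++ w' ++ e} →
      ∀ p, act M.optionStep p (e ++ w ++ e) = act M.optionStep p (e ++ w' ++ e) := by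
    intro e w w' he h p
    have he0 : e ≠ [] := List.length_pos_iff.mp (hk.1.trans_le he)
    rw [act_optionStep, act_optionStep]
    congr 1
    funext q
    refine hM.run_eq (fun x y => ?_) q
    obtain ⟨u, hu⟩ := FreeSemigroup.exists_letters_eq (w := x ++ (e ++ w ++ e) ++ y) (by simp [he0])
    obtain ⟨v, hv⟩ := FreeSemigroup.exists_letters_eq (w := x ++ (e ++ w' ++ e) ++ y)
      (by simp [he0])
    rw [← hu, ← hv]
    exact hk.2 u v (sameKTests_of_factors_eq he hu hv h)
  have hF : ∀ e w w' : List A, k ≤ e.length →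
      {f | f.length = k ∧ f <:+: e ++ (w ++ e ++ w') ++ e} =
      {f | f.length = k ∧ f <:+: e ++ w ++ e} ∪ {f | f.length = k ∧ f <:+: e ++ w' ++ e} := by
    intro e w w' he
    have := factors_append_append (k := k) (e := e) (by omega) (e ++ w) (w' ++ e)
    simpa only [List.append_assoc] using this
  constructor
  · intro e w he p
    have := key e (w ++ e ++ w) w he (by rw [hF e w w he, Set.union_self]) p
    simpa only [List.append_assoc] using this
  · intro e w w' he p
    have := key e (w ++ e ++ w') (w' ++ e ++ w) he
      (by rw [hF e w w' he, hF e w' w he, Set.union_comm]) p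
    simpa only [List.append_assoc] using this

/-- The elements of the transition semigroup that are induced by letters. -/
abbrev LetterAction (M : PartialDFA A Q) : Type v :=
  {f : M.transitionSemigroup // ∃ a, f.1 = fun q => M.step q a}

/-- Reading a word over the letter actions. -/
def letterActionStep (M : PartialDFA A Q) (p : Option Q) (b : M.LetterAction) : Option Q :=
  p.bind b.1.1

theorem lift_letterAction (M : PartialDFA A Q) (w : FreeSemigroup M.LetterAction) :
    (FreeSemigroup.lift (fun b : M.LetterAction => b.1) w).1 =
      fun q => act M.letterActionStep (some q) w.letters := by
  have hact : ∀ (l : List M.LetterAction) (p : Option Q), act M.letterActionStep p l =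
      p.bind fun q => act M.letterActionStep (some q) l := by
    intro l p
    cases p with
    | none => exact act_none (fun _ => rfl) l
    | some q => rfl
  induction w using FreeSemigroup.recOnMul with
  | ih1 b => rfl
  | ih2 b w h1 h2 =>
    rw [map_mul, FreeSemigroup.letters_mul]
    funext q
    rw [act_append, hact]
    change Option.bind ((FreeSemigroup.lift (fun b : M.LetterAction => b.1) _).1 q) _ = _
    rw [h1, h2]

theorem exists_letter (M : PartialDFA A Q) :
    ∃ c : M.LetterAction → A, ∀ (w : List M.LetterAction) (p : Option Q),
      act M.letterActionStep p w = act M.optionStep p (w.map c) := by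
  choose c hc using fun b : M.LetterAction => b.2
  refine ⟨c, fun w p => ?_⟩
  have : M.letterActionStep = fun p b => M.optionStep p (c b) := by
    funext p b
    rw [letterActionStep, hc]
    rfl
  rw [this, act, act, List.foldl_map]

theorem lift_letterAction_surjective (M : PartialDFA A Q) :
    Function.Surjective (FreeSemigroup.lift fun b : M.LetterAction => b.1) := by
  rintro ⟨f, w, rfl⟩
  let g : A → M.LetterAction := fun a =>
    ⟨⟨fun q => M.step q a, ⟨a, []⟩, funext fun q => by simp [FreeSemigroup.letters, run]⟩, a, rfl⟩
  refine ⟨⟨g w.head, w.tail.map g⟩, Subtype.ext ?_⟩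
  rw [lift_letterAction]
  funext q
  change act M.letterActionStep (some q) (w.letters.map g) = _
  rw [act, List.foldl_map]
  exact M.act_optionStep (some q) w.letters

/-- The local identities hold for all words, so they pass to the letter actions by choosing an
inducing letter for each. -/
theorem locallySemilattice_letterActionStep (M : PartialDFA A Q) {N : ℕ}
    (H : LocallySemilattice M.optionStep N) : LocallySemilattice M.letterActionStep N := by
  obtain ⟨c, hc⟩ := M.exists_letter
  constructor
  · intro e w he p
    simpa only [hc, List.map_append] using
      H.idem (e.map c) (w.map c) (by rwa [List.length_map]) p
  · intro e w w' he p
    simpa only [hc, List.map_append] using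
      H.comm (e.map c) (w.map c) (w'.map c) (by rwa [List.length_map]) p

end PartialDFA

theorem LocallySemilattice.act_eq_of_sameKTests [Fintype Q] {δ : Option Q → A → Option Q} {N : ℕ}
    (H : LocallySemilattice δ N) (hδ : ∀ a, δ none a = none) {u v : FreeSemigroup A}
    (h : SameKTests ((Fintype.card Q).choose 2 + 1) u v) (p : Option Q) :
    act δ p u.letters = act δ p v.letters :=
  H.act_eq hδ rfl h.1 h.2.1 h.2.2 p

end Automaton

theorem theorem5p2 {A : Type u} {Q : Type v} [Fintype Q] (n : ℕ) (hn : Fintype.card Q = n)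
    (M : PartialDFA A Q) (hred : M.IsReduced) (hloc : M.LocallyTestable) :
    SemigroupKTestable ((n ^ 2 - n) / 2 + 1) M.transitionSemigroup ∧
      M.KTestable ((n ^ 2 - n) / 2 + 1) := by
  have hc : (n ^ 2 - n) / 2 = (Fintype.card Q).choose 2 := by
    rw [hn, Nat.choose_two_right, Nat.mul_sub_one, sq]
  rw [hc]
  obtain ⟨k, hk⟩ := hloc
  have H := hred.locallySemilattice hk
  refine ⟨⟨Nat.succ_pos _, M.LetterAction, FreeSemigroup.lift fun b => b.1,
    M.lift_letterAction_surjective, fun u v huv => Subtype.ext ?_⟩, Nat.succ_pos _,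
    fun u v huv => ?_⟩
  · rw [M.lift_letterAction, M.lift_letterAction]
    funext q
    exact (M.locallySemilattice_letterActionStep H).act_eq_of_sameKTests (fun _ => rfl) huv _
  · have h := H.act_eq_of_sameKTests (fun _ => rfl) huv (some M.start)
    rw [M.act_optionStep, M.act_optionStep] at h
    change M.run M.start u.letters = M.run M.start v.letters at h
    change M.AcceptsFrom M.start u.letters ↔ M.AcceptsFrom M.start v.letters
    rw [PartialDFA.AcceptsFrom, PartialDFA.AcceptsFrom, h]
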